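/- Let $S_j(x)=\frac x2+\frac j4$ for $j=0,1,2$. For a word $\sigma=(\sigma_1,\dots,\sigma_n)\in\{0,1,2\}^n$ put $S_\sigma=S_{\sigma_1}\circ\dots\circ S_{\sigma_n}$. Let $g_n=\{S_\sigma(0):|\sigma|=n\}$ be the set of nodes at level $n\ge 0$ of the $(3,2)$-graph, give the node $z\in g_n$ the weight $w_z=3^{-n}\,\#\{\sigma\in\{0,1,2\}^n:S_\sigma(0)=z\}$, and let $$h_{3,2}(n)=-\sum_{z\in g_n}w_z\log_2 w_z$$ be the entropy of level $n$ (so $h_{3,2}(0)=0$). Let $H_{3,2}(x)=\sum_{n\ge 0}h_{3,2}(n)x^n$ be the entropy generating function. For positive integers $k,i$ let $e(k,i)$ be the number of steps of the simple (subtractive) Euclidean algorithm $\{a,b\}\mapsto\{a,b-a\}$ $(a<b)$ that reduce $\{k,i\}$ to $\{g,g\}$ with $g=\gcd(k,i)$. For each $n\geq 0$ there are only finitely many pairs with $k>i\ge1$, $\gcd(i,k)=1$, $e(k,i)=n$. Let $$s(n)=\sum_{\substack{k>i\ge 1,\ \gcd(i,k)=1\\ e(k,i)=n}}k\log_2 k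 ,$$ let $\ell(n)$ be the coefficient of $x^n$ in the formal power series $(1-3x)^2\sum_{n\ge 0} s(n)x^n$, and put $L(x)=\sum_{n\ge 0}\ell(n)x^n$ (here $s(0)=\ell(0)=0$). **Theorem 3.1.** The series defining $L$ converges for all complex $x$ with $|x|<1$, and for $|x|<1/3$ the series $\sum_n s(n)x^n$ converges and $L(x)=(1-3x)^2\sum_{n}s(n)x^n$. The function $$T_{3,2}(x)=\log_2 3-\frac{2}{3(1-x/3)^2}\,L(x/3)$$ is analytic on the disk $|x|<3$, and for all complex $x$ with $|x|<1$ the series $H_{3,2}(x)$ converges and $$H_{3,2}(x)=\frac{x}{(x-1)^2}\,T_{3,2}(x).$$ -/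

import Mathlib

/-- The contraction `S_j(x) = x/d + (j/d) (d-1)/(m-1)` on `ℝ`. -/
noncomputable def contraction (m d : ℕ) (j : Fin m) (x : ℝ) : ℝ :=
  x / d + ((j : ℕ) : ℝ) / d * (((d : ℝ) - 1) / ((m : ℝ) - 1))

/-- `S_σ(0)` for the word `σ = (σ_1, …, σ_n)`, where `S_σ = S_{σ_1} ∘ ⋯ ∘ S_{σ_n}`. -/
noncomputable def wordPoint (m d : ℕ) {n : ℕ} (σ : Fin n → Fin m) : ℝ :=
  (List.ofFn σ).foldr (contraction m d) 0

/-- The nodes at level `n` of the `(m,d)`-graph: the distinct points `S_σ(0)`, `|σ| = n`. -/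
noncomputable def levelNodes (m d n : ℕ) : Finset ℝ :=
  Finset.univ.image (fun σ : Fin n → Fin m => wordPoint m d σ)

open Classical in
/-- The weight `w_z = ∑ p_σ` of the node `z` at level `n`; the sum is over all words `σ` of
length `n` with `S_σ(0) = z`, and `p_σ = p_{σ_1} ⋯ p_{σ_n}`. -/
noncomputable def nodeWeight (m d : ℕ) (p : Fin m → ℝ) (n : ℕ) (z : ℝ) : ℝ :=
  ∑ σ : Fin n → Fin m with wordPoint m d σ = z, ∏ j, p (σ j)

/-- The entropy `-∑_z w_z log₂ w_z` of level `n` of the weighted `(m,d)`-graph. -/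
noncomputable def levelEntropy (m d : ℕ) (p : Fin m → ℝ) (n : ℕ) : ℝ :=
  -∑ z ∈ levelNodes m d n, nodeWeight m d p n z * Real.logb 2 (nodeWeight m d p n z)

/-- `h_{m,d}(n)`: the entropy of level `n` in the uniform case `p_i = 1/m`. -/
noncomputable def uniformEntropy (m d n : ℕ) : ℝ :=
  levelEntropy m d (fun _ => 1 / (m : ℝ)) n

/-- The number of subtraction steps by which the simple Euclidean algorithm reduces the pair
`{a, b}` of positive integers to `{g, g}`, `g = gcd(a, b)`. For coprime `a, b` this is the level
of `{a, b}` in the Euclidean tree (with root `{1, 1}` at level `0`). Pairs containing `0` are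
never used. -/
def euclidSteps (a b : ℕ) : ℕ :=
  if a = 0 ∨ b = 0 ∨ a = b then 0
  else if a < b then euclidSteps a (b - a) + 1
  else euclidSteps (a - b) b + 1
termination_by a + b

/-- The pairs `(k, i)` with `k > i ≥ 1`, `gcd(i, k) = 1` and `e(k, i) = n`. -/
def euclidLevel (n : ℕ) : Set (ℕ × ℕ) :=
  {q | 1 ≤ q.2 ∧ q.2 < q.1 ∧ Nat.gcd q.2 q.1 = 1 ∧ euclidSteps q.1 q.2 = n}

theorem add_le_two_pow_euclidSteps (N : ℕ) : ∀ a b : ℕ, a + b ≤ N → 0 < a → 0 < b →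
    a + b ≤ Nat.gcd a b * 2 ^ (euclidSteps a b + 1) := by
  induction N with
  | zero => intro a b h ha hb; omega
  | succ N ih =>
    intro a b h ha hb
    rw [euclidSteps]
    by_cases hab : a = b
    · subst hab
      simp
      omega
    · rw [if_neg (by omega)]
      by_cases hlt : a < b
      · rw [if_pos hlt]
        have h1 := ih a (b - a) (by omega) ha (by omega)
        rw [Nat.gcd_sub_self_right hlt.le] at h1
        rw [pow_succ, ← mul_assoc]
        omega
      · rw [if_neg hlt]
        have h1 := ih (a - b) b (by omega) (by omega) hb
        rw [Nat.gcd_sub_self_left (by omega)] at h1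
        rw [pow_succ, ← mul_assoc]
        omega

theorem euclidLevel_finite (n : ℕ) : (euclidLevel n).Finite := by
  apply ((Finset.range (2 ^ (n + 1) + 1)) ×ˢ (Finset.range (2 ^ (n + 1) + 1))).finite_toSet.subset
  rintro ⟨k, i⟩ ⟨h1, h2, h3, h4⟩
  simp only at h1 h2 h3 h4
  have h := add_le_two_pow_euclidSteps (k + i) k i le_rfl (by omega) (by omega)
  rw [Nat.gcd_comm, h3, h4, one_mul] at h
  simp only [Finset.coe_product, Set.mem_prod, Finset.mem_coe, Finset.mem_range]
  omega

/-- The sum of `k log₂ k` over all pairs `(k, i)` with `k > i ≥ 1`, `gcd(i, k) = 1` and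
`e(k, i) = n`. -/
noncomputable def euclidLevelSum (n : ℕ) : ℝ :=
  ∑ q ∈ (euclidLevel_finite n).toFinset, (q.1 : ℝ) * Real.logb 2 (q.1 : ℝ)

/-- `ℓ(n)`: the `n`-th coefficient of the formal power series
`(1 - 3X)² ∑_n (∑_{e(k,i) = n} k log₂ k) Xⁿ`. -/
noncomputable def ellCoeff (n : ℕ) : ℝ :=
  PowerSeries.coeff n
    ((1 - 3 * PowerSeries.X) ^ 2 * PowerSeries.mk euclidLevelSum : PowerSeries ℝ)

/-- The function `L(z) = ∑ ℓ(n) zⁿ`, meant for `|z| < 1`. -/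
noncomputable def ellFun (z : ℂ) : ℂ := ∑' n : ℕ, (ellCoeff n : ℂ) * z ^ n

/-- `T_{3,2}(x) = log₂ 3 - 2 / (3 (1 - x/3)²) · L(x/3)`. -/
noncomputable def T32 (x : ℂ) : ℂ :=
  (Real.logb 2 3 : ℂ) - 2 / (3 * (1 - x / 3) ^ 2) * ellFun (x / 3)

/-! Write P for `fareyOp`, f(k) = k log₂ k, s for `euclidLevelSum`. Shifted by one, the word counts
at level n form row n of Stern's diatomic array: the next row keeps every entry and inserts the sum
of each two neighbours. Hence P carries a sum over neighbouring pairs one row back, just as it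
carries a sum over the Euclidean tree one level back. The end pairs (0,1) and (1,0) each shed a new
tree rooted at (1,1) at every step, so f sums over row n to 2 ∑ (n - j) s(j). Since h(n) is n log₂ 3
minus this sum over 3ⁿ, a Cauchy product gives the formula for H.

Convergence of L needs ℓ bounded (`abs_ellCoeff_add_three_le`). Here s(n+2) - 3 s(n+1) = PⁿΔ(1,1)
with Δ = `fareyDefect`, and Δ scales linearly under multiplication by 3, so ℓ(n+3) = PⁿΔ(1,2) +
PⁿΔ(2,1) - PⁿΔ(3,3). This failure of additivity is a Jensen gap, quadratic in the determinant ad -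
bc. P preserves the determinant, and the weight 1/(ef(e+f)) does not grow under P, so the bound is
uniform in n. -/

/-- The transfer operator of the Farey tree on functions of two natural numbers. -/
def fareyOp (G : ℕ → ℕ → ℝ) : ℕ → ℕ → ℝ := fun a b => G a (a + b) + G (a + b) b

/-- The function `k log₂ k`. -/
noncomputable def mulLogTwo (k : ℕ) : ℝ := (k : ℝ) * Real.logb 2 (k : ℝ)

theorem mulLogTwo_zero : mulLogTwo 0 = 0 := by simp [mulLogTwo]

theorem mulLogTwo_one : mulLogTwo 1 = 0 := by simp [mulLogTwo]

/-! ### The Euclidean tree -/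

/-- The `n`-th level of the Euclidean tree, as ordered pairs. -/
def euclidTree : ℕ → Finset (ℕ × ℕ)
  | 0 => {(1, 1)}
  | n + 1 => (euclidTree n).image (fun q => (q.1, q.1 + q.2)) ∪
      (euclidTree n).image (fun q => (q.1 + q.2, q.2))

theorem euclidSteps_self (a : ℕ) : euclidSteps a a = 0 := by
  rw [euclidSteps]; simp

theorem euclidSteps_add_right {a b : ℕ} (ha : 0 < a) (hb : 0 < b) :
    euclidSteps a (a + b) = euclidSteps a b + 1 := by
  rw [euclidSteps, if_neg (by omega), if_pos (by omega), Nat.add_sub_cancel_left]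

theorem euclidSteps_add_left {a b : ℕ} (ha : 0 < a) (hb : 0 < b) :
    euclidSteps (a + b) b = euclidSteps a b + 1 := by
  rw [euclidSteps, if_neg (by omega), if_neg (by omega), Nat.add_sub_cancel]

theorem mem_euclidTree (n : ℕ) : ∀ a b : ℕ,
    (a, b) ∈ euclidTree n ↔ 0 < a ∧ 0 < b ∧ Nat.Coprime a b ∧ euclidSteps a b = n := by
  induction n with
  | zero =>
    intro a b
    simp only [euclidTree, Finset.mem_singleton, Prod.mk.injEq]
    constructor
    · rintro ⟨rfl, rfl⟩
      simp [euclidSteps_self]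
    · rintro ⟨ha, hb, hc, he⟩
      have hab : a = b := by
        by_contra hne
        rw [euclidSteps, if_neg (by omega)] at he
        split_ifs at he
      subst hab
      simpa using hc
  | succ n ih =>
    intro a b
    simp only [euclidTree, Finset.mem_union, Finset.mem_image, Prod.exists, Prod.mk.injEq]
    constructor
    · rintro (⟨c, d, h, rfl, rfl⟩ | ⟨c, d, h, rfl, rfl⟩) <;>
        obtain ⟨hc, hd, hcd, he⟩ := (ih c d).1 h
      · refine ⟨hc, by omega, by simpa using hcd, ?_⟩
        rw [euclidSteps_add_right hc hd, he]
      · refine ⟨by omega, hd, by simpa using hcd, ?_⟩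
        rw [euclidSteps_add_left hc hd, he]
    · rintro ⟨ha, hb, hc, he⟩
      rcases lt_trichotomy a b with h | h | h
      · left
        obtain ⟨d, rfl⟩ := Nat.exists_eq_add_of_lt h
        rw [add_assoc] at hc he ⊢
        rw [euclidSteps_add_right ha (by omega)] at he
        exact ⟨a, d + 1, (ih _ _).2 ⟨ha, by omega, by simpa using hc, by omega⟩, rfl, rfl⟩
      · subst h
        rw [euclidSteps_self] at he
        omega
      · right
        obtain ⟨d, rfl⟩ := Nat.exists_eq_add_of_lt h
        rw [show b + d + 1 = (d + 1) + b by ring] at hc he ⊢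
        rw [euclidSteps_add_left (by omega) hb] at he
        exact ⟨d + 1, b, (ih _ _).2 ⟨by omega, hb, by simpa using hc, by omega⟩, rfl, rfl⟩

theorem sum_euclidTree_succ (n : ℕ) (G : ℕ → ℕ → ℝ) :
    ∑ q ∈ euclidTree (n + 1), G q.1 q.2 = ∑ q ∈ euclidTree n, fareyOp G q.1 q.2 := by
  rw [euclidTree, Finset.sum_union, Finset.sum_image, Finset.sum_image,
    ← Finset.sum_add_distrib]
  · rfl
  · rintro ⟨a, b⟩ _ ⟨c, d⟩ _ h
    simp only [Prod.mk.injEq] at h ⊢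
    omega
  · rintro ⟨a, b⟩ _ ⟨c, d⟩ _ h
    simp only [Prod.mk.injEq] at h ⊢
    omega
  -- Entries are positive, so one image has first < second and the other first > second.
  · rw [Finset.disjoint_left]
    rintro ⟨a, b⟩ h1 h2
    simp only [Finset.mem_image, Prod.exists, Prod.mk.injEq] at h1 h2
    obtain ⟨c, d, h, h3, h4⟩ := h1
    obtain ⟨c', d', h', h3', h4'⟩ := h2
    have := (mem_euclidTree n c d).1 h
    have := (mem_euclidTree n c' d').1 h'
    omega

theorem sum_euclidTree (n : ℕ) : ∀ G : ℕ → ℕ → ℝ,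
    ∑ q ∈ euclidTree n, G q.1 q.2 = fareyOp^[n] G 1 1 := by
  induction n with
  | zero => intro G; simp [euclidTree]
  | succ n ih =>
    intro G
    rw [sum_euclidTree_succ, ih, Function.iterate_succ_apply]

theorem euclidLevelSum_zero : euclidLevelSum 0 = 0 := by
  apply Finset.sum_eq_zero
  rintro ⟨k, i⟩ h
  obtain ⟨h1, h2, h3, h4⟩ := (euclidLevel_finite 0).mem_toFinset.1 h
  simp only at h1 h2 h3 h4
  have := ((mem_euclidTree 0 k i).2 ⟨by omega, by omega, Nat.Coprime.symm h3, h4⟩)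
  simp only [euclidTree, Finset.mem_singleton, Prod.mk.injEq] at this
  omega

theorem euclidLevelSum_succ (n : ℕ) :
    euclidLevelSum (n + 1) = ∑ q ∈ euclidTree n, mulLogTwo (q.1 + q.2) := by
  have h : (euclidLevel_finite (n + 1)).toFinset =
      (euclidTree n).image (fun q => (q.1 + q.2, q.2)) := by
    ext ⟨k, i⟩
    simp only [Set.Finite.mem_toFinset, Finset.mem_image, Prod.exists, Prod.mk.injEq]
    constructor
    · rintro ⟨h1, h2, h3, h4⟩
      simp only at h1 h2 h3 h4
      obtain ⟨d, rfl⟩ := Nat.exists_eq_add_of_lt h2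
      rw [show i + d + 1 = (d + 1) + i by ring] at h3 h4 ⊢
      rw [euclidSteps_add_left (by omega) (by omega)] at h4
      refine ⟨d + 1, i, (mem_euclidTree _ _ _).2 ⟨by omega, by omega, ?_, by omega⟩, rfl, rfl⟩
      exact Nat.Coprime.symm (by simpa using h3)
    · rintro ⟨c, d, h, rfl, rfl⟩
      obtain ⟨hc, hd, hcd, he⟩ := (mem_euclidTree _ _ _).1 h
      refine ⟨hd, by simp only; omega, ?_, ?_⟩
      · simpa using hcd.symm
      · simp only
        rw [euclidSteps_add_left hc hd, he]
  rw [euclidLevelSum, h, Finset.sum_image]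
  · rfl
  · rintro ⟨a, b⟩ _ ⟨c, d⟩ _ h
    simp only [Prod.mk.injEq] at h ⊢
    omega

theorem euclidLevelSum_succ_eq_iterate (n : ℕ) :
    euclidLevelSum (n + 1) = fareyOp^[n] (fun a b => mulLogTwo (a + b)) 1 1 := by
  rw [euclidLevelSum_succ, ← sum_euclidTree]

/-! ### Word counts and Stern's diatomic array -/

/-- The integer with base-two digits `σ_i ∈ {0, 1, 2}`, the last digit being the least
significant one. -/
def digitValue : (n : ℕ) → (Fin n → Fin 3) → ℕ
  | 0, _ => 0
  | n + 1, σ => 2 * digitValue n (Fin.init σ) + (σ (Fin.last n) : ℕ)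

theorem digitValue_add_one_lt (n : ℕ) : ∀ σ, digitValue n σ + 1 < 2 ^ (n + 1) := by
  induction n with
  | zero => intro σ; simp [digitValue]
  | succ n ih =>
    intro σ
    have h1 := ih (Fin.init σ)
    have h2 := (σ (Fin.last n)).isLt
    rw [digitValue, pow_succ]
    omega

theorem foldr_contraction_three_two (n : ℕ) : ∀ (σ : Fin n → Fin 3) (x : ℝ),
    (List.ofFn σ).foldr (contraction 3 2) x = (2 * x + digitValue n σ) / 2 ^ (n + 1) := by
  induction n with
  | zero => intro σ x; simp [digitValue]
  | succ n ih =>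
    intro σ x
    rw [List.ofFn_succ', List.concat_eq_append, List.foldr_append]
    have h := ih (Fin.init σ) (contraction 3 2 (σ (Fin.last n)) x)
    simp only [List.foldr_cons, List.foldr_nil]
    refine h.trans ?_
    simp only [digitValue, contraction]
    push_cast
    field_simp
    ring

theorem wordPoint_three_two {n : ℕ} (σ : Fin n → Fin 3) :
    wordPoint 3 2 σ = (digitValue n σ : ℝ) / 2 ^ (n + 1) := by
  rw [wordPoint, foldr_contraction_three_two]
  simp

/-- The rows of Stern's diatomic array started from `0, 1, 0`. -/
def sternRow (n i : ℕ) : ℕ :=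
  (Finset.univ.filter (fun σ : Fin n → Fin 3 => digitValue n σ + 1 = i)).card

theorem sternRow_zero (i : ℕ) : sternRow 0 i = if i = 1 then 1 else 0 := by
  by_cases h : i = 1
  · simp [sternRow, digitValue, h]
  · simp [sternRow, digitValue, h, Ne.symm h]

theorem sternRow_succ (n i : ℕ) : sternRow (n + 1) i =
    ∑ j : Fin 3, (Finset.univ.filter
      (fun σ : Fin n → Fin 3 => 2 * digitValue n σ + (j : ℕ) + 1 = i)).card := by
  simp only [sternRow, Finset.card_filter]
  rw [← (Fin.snocEquiv (fun _ : Fin (n + 1) => Fin 3)).sum_comp, Fintype.sum_prod_type]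
  simp [digitValue, Fin.snocEquiv]

/-- Parity forces the last digit to be 1; in the odd case it is 0 or 2, one for each neighbour. -/
theorem sternRow_succ_even (n i : ℕ) : sternRow (n + 1) (2 * i) = sternRow n i := by
  rw [sternRow_succ, Fin.sum_univ_three, Finset.card_eq_zero.2, zero_add, Nat.add_eq_left.2]
  · simp only [sternRow]
    congr 1; ext σ; simp; omega
  · rw [Finset.card_eq_zero, Finset.filter_eq_empty_iff]
    intro σ _; simp; omega
  · rw [Finset.filter_eq_empty_iff]
    intro σ _; simp; omega

theorem sternRow_succ_odd (n i : ℕ) :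
    sternRow (n + 1) (2 * i + 1) = sternRow n i + sternRow n (i + 1) := by
  rw [sternRow_succ, Fin.sum_univ_three, add_comm, ← add_assoc, Nat.add_eq_left.2]
  · simp only [sternRow]
    congr 2
    · ext σ; simp; omega
    · ext σ; simp
  · rw [Finset.card_eq_zero, Finset.filter_eq_empty_iff]
    intro σ _; simp; omega

theorem sum_range_two_mul (m : ℕ) (f : ℕ → ℝ) :
    ∑ i ∈ Finset.range (2 * m), f i = ∑ i ∈ Finset.range m, (f (2 * i) + f (2 * i + 1)) := by
  induction m with
  | zero => simp
  | succ m ih =>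
    rw [Nat.mul_succ, Finset.sum_range_succ, Finset.sum_range_succ, ih, Finset.sum_range_succ,
      add_assoc]

/-- The sum of `G` over the pairs of neighbours in row `n` of Stern's array. -/
def sternPairSum (n : ℕ) (G : ℕ → ℕ → ℝ) : ℝ :=
  ∑ i ∈ Finset.range (2 ^ (n + 1)), G (sternRow n i) (sternRow n (i + 1))

theorem sternPairSum_succ (n : ℕ) (G : ℕ → ℕ → ℝ) :
    sternPairSum (n + 1) G = sternPairSum n (fareyOp G) := by
  rw [sternPairSum, pow_succ', sum_range_two_mul, sternPairSum]
  refine Finset.sum_congr rfl fun i _ => ?_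
  rw [show 2 * i + 1 + 1 = 2 * (i + 1) by ring, sternRow_succ_even, sternRow_succ_even,
    sternRow_succ_odd, fareyOp]

theorem sternPairSum_eq_iterate (n : ℕ) : ∀ G : ℕ → ℕ → ℝ,
    sternPairSum n G = fareyOp^[n] G 0 1 + fareyOp^[n] G 1 0 := by
  induction n with
  | zero => intro G; simp [sternPairSum, sternRow_zero, Finset.sum_range_succ]
  | succ n ih => intro G; rw [sternPairSum_succ, ih, Function.iterate_succ_apply]

/-- The sum `∑ c log₂ c` over row `n` of Stern's array. -/
noncomputable def sternLogSum (n : ℕ) : ℝ :=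
  ∑ i ∈ Finset.range (2 ^ (n + 1)), mulLogTwo (sternRow n i)

/-- One step sends (0,1) to (0,1) and (1,1), and (1,0) to (1,1) and (1,0); each (1,1) then
contributes a full tree level. -/
theorem sternPairSum_add_eq (n : ℕ) : sternPairSum n (fun a b => mulLogTwo (a + b)) =
    2 * ∑ j ∈ Finset.range (n + 1), euclidLevelSum j := by
  induction n with
  | zero => simp [sternPairSum_eq_iterate, mulLogTwo_one, euclidLevelSum_zero]
  | succ n ih =>
    rw [Finset.sum_range_succ, mul_add, ← ih, euclidLevelSum_succ_eq_iterate,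
      sternPairSum_eq_iterate, sternPairSum_eq_iterate, Function.iterate_succ_apply']
    simp only [fareyOp, Nat.zero_add, Nat.add_zero]
    ring

/-- For G(a,b) = f(a), the image PG is f(a) + f(a+b): old entries plus inserted ones. -/
theorem sternLogSum_succ (n : ℕ) : sternLogSum (n + 1) =
    sternLogSum n + 2 * ∑ j ∈ Finset.range (n + 1), euclidLevelSum j := by
  have h := sternPairSum_succ n (fun a _ => mulLogTwo a)
  rw [← sternPairSum_add_eq]
  simpa [sternPairSum, sternLogSum, fareyOp, Finset.sum_add_distrib] using h

theorem sternLogSum_eq (n : ℕ) : sternLogSum n =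
    2 * ∑ p ∈ Finset.HasAntidiagonal.antidiagonal n, (p.1 : ℝ) * euclidLevelSum p.2 := by
  induction n with
  | zero => simp [sternLogSum, sternRow_zero, Finset.sum_range_succ, mulLogTwo_zero,
      mulLogTwo_one]
  | succ n ih =>
    have h : ∑ j ∈ Finset.range (n + 1), euclidLevelSum j =
        ∑ p ∈ Finset.HasAntidiagonal.antidiagonal n, euclidLevelSum p.2 := by
      rw [← Finset.Nat.sum_antidiagonal_swap,
        Finset.Nat.sum_antidiagonal_eq_sum_range_succ_mk]
      rfl
    rw [sternLogSum_succ, ih, Finset.Nat.sum_antidiagonal_succ, ← mul_add, h,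
      ← Finset.sum_add_distrib]
    simp only [Nat.cast_zero, zero_mul, zero_add, Nat.cast_add, Nat.cast_one]
    simp only [add_mul, one_mul]

theorem sternRow_eq_card (n i : ℕ) : sternRow n i = (Finset.univ.filter
    (fun σ : Fin n → Fin 3 => wordPoint 3 2 σ = ((i : ℝ) - 1) / 2 ^ (n + 1))).card := by
  rw [sternRow]
  congr 1
  ext σ
  simp only [Finset.mem_filter, Finset.mem_univ, true_and, wordPoint_three_two]
  rw [div_left_inj' (by positivity), eq_sub_iff_add_eq]
  norm_cast

/-! ### Entropy of a level -/

open Classical in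
theorem uniformEntropy_three_two (n : ℕ) :
    uniformEntropy 3 2 n = n * Real.logb 2 3 - sternLogSum n / 3 ^ n := by
  set c : ℝ → ℕ := fun z => (Finset.univ.filter
    (fun σ : Fin n → Fin 3 => wordPoint 3 2 σ = z)).card with hc
  have hw : ∀ z, nodeWeight 3 2 (fun _ => 1 / ((3 : ℕ) : ℝ)) n z = c z / 3 ^ n := by
    intro z
    simp [nodeWeight, hc, div_eq_mul_inv]
  have hcard : ∑ z ∈ levelNodes 3 2 n, (c z : ℝ) = 3 ^ n := by
    have h := Finset.card_eq_sum_card_image (wordPoint 3 2) (Finset.univ : Finset (Fin n → Fin 3))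
    rw [Finset.card_univ, Fintype.card_fun, Fintype.card_fin, Fintype.card_fin] at h
    rw [levelNodes, ← Nat.cast_sum]
    exact_mod_cast h.symm
  have hlog : ∑ z ∈ levelNodes 3 2 n, mulLogTwo (c z) = sternLogSum n := by
    have hinj : Function.Injective (fun i : ℕ => ((i : ℝ) - 1) / 2 ^ (n + 1)) := by
      intro i j h
      simp only at h
      rw [div_left_inj' (by positivity), sub_left_inj] at h
      exact_mod_cast h
    have himg : sternLogSum n = ∑ z ∈ (Finset.range (2 ^ (n + 1))).image
        (fun i : ℕ => ((i : ℝ) - 1) / 2 ^ (n + 1)), mulLogTwo (c z) := by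
      rw [Finset.sum_image hinj.injOn, sternLogSum]
      refine Finset.sum_congr rfl fun i _ => ?_
      rw [sternRow_eq_card]
    rw [himg]
    apply Finset.sum_subset
    · intro z hz
      obtain ⟨σ, -, rfl⟩ := Finset.mem_image.1 hz
      refine Finset.mem_image.2 ⟨digitValue n σ + 1, Finset.mem_range.2
        (digitValue_add_one_lt n σ), ?_⟩
      rw [wordPoint_three_two]
      simp
    -- Points that are not nodes, such as the one with index 0, contribute nothing because f(0) = 0.
    · intro z _ hz
      have : c z = 0 := by
        rw [hc]
        simp only [Finset.card_eq_zero, Finset.filter_eq_empty_iff]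
        intro σ _ h
        exact hz (Finset.mem_image.2 ⟨σ, Finset.mem_univ _, h⟩)
      rw [this, mulLogTwo_zero]
  have hterm : ∀ z ∈ levelNodes 3 2 n, (c z / 3 ^ n : ℝ) * Real.logb 2 (c z / 3 ^ n) =
      mulLogTwo (c z) / 3 ^ n - c z * (n * Real.logb 2 3 / 3 ^ n) := by
    intro z hz
    obtain ⟨σ, -, rfl⟩ := Finset.mem_image.1 hz
    have hpos : (c (wordPoint 3 2 σ) : ℝ) ≠ 0 := by
      rw [Nat.cast_ne_zero, hc]
      simp only
      rw [Finset.card_ne_zero]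
      exact ⟨σ, by simp⟩
    rw [Real.logb_div hpos (by positivity), Real.logb_pow, mulLogTwo]
    ring
  rw [uniformEntropy, levelEntropy]
  simp only [hw]
  rw [Finset.sum_congr rfl hterm, Finset.sum_sub_distrib, ← Finset.sum_div, ← Finset.sum_mul,
    hcard, hlog]
  field_simp
  ring

/-! ### Near-additivity of the defect -/

/-- The function X log(X/p) is convex and homogeneous, hence subadditive in (X,p). Both bounds come
from 1 - 1/t ≤ log t ≤ t - 1 at t = U(p+q)/(V(X+Y)). -/
theorem mul_log_jensen_gap {X Y p q : ℝ} (hX : 0 < X) (hY : 0 < Y) (hp : 0 < p) (hq : 0 < q) :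
    0 ≤ X * (Real.log X - Real.log p) + Y * (Real.log Y - Real.log q) -
        (X + Y) * (Real.log (X + Y) - Real.log (p + q)) ∧
    X * (Real.log X - Real.log p) + Y * (Real.log Y - Real.log q) -
        (X + Y) * (Real.log (X + Y) - Real.log (p + q)) ≤
      (X * q - Y * p) ^ 2 / (p * q * (X + Y)) := by
  have key : ∀ {U V : ℝ}, 0 < U → 0 < V → U * (Real.log U - Real.log V -
      Real.log (X + Y) + Real.log (p + q)) ≤ U * (U * (p + q) / (V * (X + Y)) - 1) ∧
      U - V * (X + Y) / (p + q) ≤ U * (Real.log U - Real.log V -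
      Real.log (X + Y) + Real.log (p + q)) := by
    intro U V hU hV
    have h1 := Real.log_le_sub_one_of_pos (x := U * (p + q) / (V * (X + Y))) (by positivity)
    have h2 := Real.one_sub_inv_le_log_of_pos (x := U * (p + q) / (V * (X + Y))) (by positivity)
    have h3 : Real.log (U * (p + q) / (V * (X + Y))) = Real.log U - Real.log V -
        Real.log (X + Y) + Real.log (p + q) := by
      rw [Real.log_div (by positivity) (by positivity), Real.log_mul hU.ne' (by positivity),
        Real.log_mul hV.ne' (by positivity)]
      ring
    rw [h3] at h1 h2
    refine ⟨mul_le_mul_of_nonneg_left h1 hU.le, ?_⟩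
    refine le_trans (le_of_eq ?_) (mul_le_mul_of_nonneg_left h2 hU.le)
    field_simp
  obtain ⟨u1, l1⟩ := key hX hp
  obtain ⟨u2, l2⟩ := key hY hq
  constructor
  · have : X - p * (X + Y) / (p + q) + (Y - q * (X + Y) / (p + q)) = 0 := by
      field_simp
      ring
    linarith
  · have : X * (X * (p + q) / (p * (X + Y)) - 1) + Y * (Y * (p + q) / (q * (X + Y)) - 1) =
        (X * q - Y * p) ^ 2 / (p * q * (X + Y)) := by
      field_simp
      ring
    linarith

/-- The image of `(a + b) log₂ (a + b)` under `fareyOp - 3`. -/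
noncomputable def fareyDefect (a b : ℕ) : ℝ :=
  mulLogTwo (2 * a + b) + mulLogTwo (a + 2 * b) - 3 * mulLogTwo (a + b)

theorem mulLogTwo_three_mul (k : ℕ) :
    mulLogTwo (3 * k) = 3 * mulLogTwo k + 3 * k * Real.logb 2 3 := by
  rcases Nat.eq_zero_or_pos k with rfl | hk
  · simp [mulLogTwo]
  · have : (k : ℝ) ≠ 0 := by positivity
    simp only [mulLogTwo]
    push_cast
    rw [Real.logb_mul (by norm_num) this]
    ring

/-- The log 3 terms cancel since (2a+b) + (a+2b) = 3(a+b). -/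
theorem fareyDefect_three_mul (a b : ℕ) : fareyDefect (3 * a) (3 * b) = 3 * fareyDefect a b := by
  simp only [fareyDefect]
  rw [show 2 * (3 * a) + 3 * b = 3 * (2 * a + b) by ring,
    show 3 * a + 2 * (3 * b) = 3 * (a + 2 * b) by ring, ← mul_add]
  simp only [mulLogTwo_three_mul]
  push_cast
  ring

theorem iterate_fareyOp_three_mul {G : ℕ → ℕ → ℝ}
    (hG : ∀ a b, G (3 * a) (3 * b) = 3 * G a b) (n : ℕ) :
    ∀ a b, fareyOp^[n] G (3 * a) (3 * b) = 3 * fareyOp^[n] G a b := by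
  induction n with
  | zero => exact hG
  | succ n ih =>
    intro a b
    rw [Function.iterate_succ_apply']
    simp only [fareyOp]
    rw [← mul_add, ih, ih, mul_add]

theorem fareyDefect_mul_log_two (a b : ℕ) : fareyDefect a b * Real.log 2 =
    (2 * a + b : ℝ) * (Real.log (2 * a + b) - Real.log (a + b)) +
    (a + 2 * b : ℝ) * (Real.log (a + 2 * b) - Real.log (a + b)) := by
  have h2 : Real.log 2 ≠ 0 := (Real.log_pos one_lt_two).ne'
  simp only [fareyDefect, mulLogTwo, Real.logb]
  push_cast
  field_simp
  ring

theorem abs_fareyDefect_gap_le {a b c d : ℕ} (ha : 0 < a) (hb : 0 < b) (hc : 0 < c) (hd : 0 < d) :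
    |fareyDefect a b + fareyDefect c d - fareyDefect (a + c) (b + d)| ≤
      2 * ((a * d - b * c : ℝ) ^ 2 / ((a + b) * (c + d) * (a + b + (c + d)))) / Real.log 2 := by
  have h2 : 0 < Real.log 2 := Real.log_pos one_lt_two
  have ha' : (0 : ℝ) < a := by exact_mod_cast ha
  have hb' : (0 : ℝ) < b := by exact_mod_cast hb
  have hc' : (0 : ℝ) < c := by exact_mod_cast hc
  have hd' : (0 : ℝ) < d := by exact_mod_cast hd
  obtain ⟨l1, u1⟩ := mul_log_jensen_gap (X := 2 * a + b) (Y := 2 * c + d) (p := a + b) (q := c + d)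
    (by positivity) (by positivity) (by positivity) (by positivity)
  obtain ⟨l2, u2⟩ := mul_log_jensen_gap (X := a + 2 * b) (Y := c + 2 * d) (p := a + b) (q := c + d)
    (by positivity) (by positivity) (by positivity) (by positivity)
  have e1 : ((2 * a + b) * (c + d) - (2 * c + d) * (a + b) : ℝ) ^ 2 /
      ((a + b) * (c + d) * (2 * a + b + (2 * c + d))) ≤
      (a * d - b * c : ℝ) ^ 2 / ((a + b) * (c + d) * (a + b + (c + d))) := by
    rw [show ((2 * a + b) * (c + d) - (2 * c + d) * (a + b) : ℝ) = a * d - b * c by ring]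
    gcongr <;> linarith
  have e2 : ((a + 2 * b) * (c + d) - (c + 2 * d) * (a + b) : ℝ) ^ 2 /
      ((a + b) * (c + d) * (a + 2 * b + (c + 2 * d))) ≤
      (a * d - b * c : ℝ) ^ 2 / ((a + b) * (c + d) * (a + b + (c + d))) := by
    rw [show ((a + 2 * b) * (c + d) - (c + 2 * d) * (a + b) : ℝ) = -(a * d - b * c) by ring, neg_sq]
    gcongr <;> linarith
  have h1 := fareyDefect_mul_log_two (a) (b)
  have h3 := fareyDefect_mul_log_two (c) (d)
  have h4 := fareyDefect_mul_log_two (a + c) (b + d)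
  push_cast at h4
  rw [show (2 * (a + c) + (b + d) : ℝ) = 2 * a + b + (2 * c + d) by ring,
    show (a + c + 2 * (b + d) : ℝ) = a + 2 * b + (c + 2 * d) by ring,
    show (a + c + (b + d) : ℝ) = a + b + (c + d) by ring] at h4
  rw [le_div_iff₀ h2, ← abs_of_pos h2, ← abs_mul, sub_mul, add_mul, h1, h3, h4,
    abs_le]
  constructor <;> linarith

/-- The pair (e,f) bounds both pairs from below and descends the tree with them, so one weight
serves both while ad - bc stays fixed. -/
theorem abs_iterate_fareyDefect_gap_le (n : ℕ) : ∀ a b c d e f : ℕ, 0 < e → 0 < f → e ≤ a → e ≤ c →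
    f ≤ b → f ≤ d →
    |fareyOp^[n] fareyDefect a b + fareyOp^[n] fareyDefect c d -
      fareyOp^[n] fareyDefect (a + c) (b + d)| ≤
      2 / Real.log 2 * ((a * d - b * c : ℝ) ^ 2 * (1 / (e * f * (e + f)))) := by
  have h2 : 0 < Real.log 2 := Real.log_pos one_lt_two
  induction n with
  | zero =>
    intro a b c d e f he hf hea hec hfb hfd
    refine (abs_fareyDefect_gap_le (by omega) (by omega) (by omega) (by omega)).trans ?_
    rw [mul_div_right_comm, div_eq_mul_one_div (_ ^ 2)]
    have he' : (0 : ℝ) < e := by exact_mod_cast he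
    have hf' : (0 : ℝ) < f := by exact_mod_cast hf
    have hea' : (e : ℝ) ≤ a := by exact_mod_cast hea
    have hec' : (e : ℝ) ≤ c := by exact_mod_cast hec
    have hfb' : (f : ℝ) ≤ b := by exact_mod_cast hfb
    have hfd' : (f : ℝ) ≤ d := by exact_mod_cast hfd
    gcongr <;> linarith
  | succ n ih =>
    intro a b c d e f he hf hea hec hfb hfd
    have he' : (0 : ℝ) < e := by exact_mod_cast he
    have hf' : (0 : ℝ) < f := by exact_mod_cast hf
    have i1 := ih a (a + b) c (c + d) e (e + f) he (by omega) hea hec (by omega) (by omega)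
    have i2 := ih (a + b) b (c + d) d (e + f) f (by omega) hf (by omega) (by omega) hfb hfd
    -- The weight 1/(ef(e+f)) is superharmonic for P, which closes the induction with the same
    -- constant.
    have hs : (1 / (e * (e + f) * (e + (e + f))) + 1 / ((e + f) * f * (e + f + f)) : ℝ) ≤
        1 / (e * f * (e + f)) := by
      rw [← sub_nonneg]
      have : (1 / (e * f * (e + f)) - (1 / (e * (e + f) * (e + (e + f))) +
          1 / ((e + f) * f * (e + f + f))) : ℝ) =
          3 / ((e + f) * (e + (e + f)) * (e + f + f)) := by
        field_simp
        ring
      rw [this]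
      positivity
    push_cast at i1 i2
    rw [show (a * (c + d) - (a + b) * c : ℝ) = a * d - b * c by ring] at i1
    rw [show ((a + b) * d - b * (c + d) : ℝ) = a * d - b * c by ring] at i2
    rw [Function.iterate_succ_apply']
    simp only [fareyOp]
    rw [show a + c + (b + d) = a + b + (c + d) by ring]
    refine (le_trans (le_of_eq ?_) (abs_add_le _ _)).trans ((add_le_add i1 i2).trans ?_)
    · congr 1; ring
    · rw [← mul_add, ← mul_add]
      gcongr

theorem euclidLevelSum_defect (n : ℕ) : euclidLevelSum (n + 2) - 3 * euclidLevelSum (n + 1) =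
    fareyOp^[n] fareyDefect 1 1 := by
  rw [euclidLevelSum_succ, euclidLevelSum_succ,
    sum_euclidTree_succ n (fun a b => mulLogTwo (a + b)), Finset.mul_sum,
    ← Finset.sum_sub_distrib, ← sum_euclidTree]
  refine Finset.sum_congr rfl fun q _ => ?_
  simp only [fareyOp, fareyDefect]
  rw [show q.1 + (q.1 + q.2) = 2 * q.1 + q.2 by ring,
    show q.1 + q.2 + q.2 = q.1 + 2 * q.2 by ring]

/-! ### Bounds on the coefficients -/

theorem ellCoeff_zero : ellCoeff 0 = euclidLevelSum 0 := by
  simp [ellCoeff]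

theorem ellCoeff_eq (n : ℕ) : ellCoeff n = euclidLevelSum n
    - 6 * (if 1 ≤ n then euclidLevelSum (n - 1) else 0)
    + 9 * (if 2 ≤ n then euclidLevelSum (n - 2) else 0) := by
  rw [ellCoeff, show ((1 - 3 * PowerSeries.X) ^ 2 * PowerSeries.mk euclidLevelSum : PowerSeries ℝ) =
    PowerSeries.mk euclidLevelSum
      - PowerSeries.C (6 : ℝ) * (PowerSeries.X ^ 1 * PowerSeries.mk euclidLevelSum)
      + PowerSeries.C (9 : ℝ) * (PowerSeries.X ^ 2 * PowerSeries.mk euclidLevelSum) by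
    rw [show (PowerSeries.C (6 : ℝ)) = 6 from map_ofNat _ 6,
      show (PowerSeries.C (9 : ℝ)) = 9 from map_ofNat _ 9]
    ring]
  simp only [map_add, map_sub, PowerSeries.coeff_C_mul, PowerSeries.coeff_X_pow_mul',
    PowerSeries.coeff_mk]

theorem ellCoeff_one : ellCoeff 1 = euclidLevelSum 1 := by
  simp [ellCoeff_eq, euclidLevelSum_zero]

theorem ellCoeff_add_two (n : ℕ) : ellCoeff (n + 2) =
    euclidLevelSum (n + 2) - 6 * euclidLevelSum (n + 1) + 9 * euclidLevelSum n := by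
  simp [ellCoeff_eq]

/-- The gap at (1,2), (2,1) with e = f = 1: squared determinant 9 and weight 1/2 turn 2/log 2 into
9/log 2. -/
theorem abs_ellCoeff_add_three_le (n : ℕ) : |ellCoeff (n + 3)| ≤ 9 / Real.log 2 := by
  have h1 := euclidLevelSum_defect n
  have h2 := euclidLevelSum_defect (n + 1)
  have h3 := iterate_fareyOp_three_mul fareyDefect_three_mul n 1 1
  have h4 := abs_iterate_fareyDefect_gap_le n 1 2 2 1 1 1 one_pos one_pos le_rfl one_le_two
    one_le_two le_rfl
  rw [Function.iterate_succ_apply', fareyOp] at h2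
  norm_num at h2 h3 h4
  rw [h3, ← h1] at h4
  rw [ellCoeff_add_two (n + 1)]
  convert h4 using 1
  · congr 1
    rw [← h2]
    ring

theorem exists_abs_ellCoeff_le : ∃ C, 0 ≤ C ∧ ∀ n, |ellCoeff n| ≤ C := by
  have h2 : 0 < Real.log 2 := Real.log_pos one_lt_two
  refine ⟨|ellCoeff 0| + |ellCoeff 1| + |ellCoeff 2| + 9 / Real.log 2, by positivity, ?_⟩
  have h0 := abs_nonneg (ellCoeff 0)
  have h1 := abs_nonneg (ellCoeff 1)
  have h3 := abs_nonneg (ellCoeff 2)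
  have h4 : 0 ≤ 9 / Real.log 2 := by positivity
  rintro (_ | _ | _ | n)
  · linarith
  · norm_num; linarith
  · norm_num; linarith
  · linarith [abs_ellCoeff_add_three_le n]

theorem exists_abs_euclidLevelSum_le :
    ∃ C, 0 ≤ C ∧ ∀ n : ℕ, |euclidLevelSum n| ≤ C * (n * 3 ^ n) := by
  obtain ⟨C, hC, h⟩ := exists_abs_ellCoeff_le
  -- The differences satisfy u(n+1) = 3u(n) + ℓ(n+2); the -1 leaves room for the added C.
  have hu : ∀ n, |euclidLevelSum (n + 1) - 3 * euclidLevelSum n| ≤ C * (2 * 3 ^ n - 1) := by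
    intro n
    induction n with
    | zero =>
      have := h 1
      rw [ellCoeff_one] at this
      simpa [euclidLevelSum_zero] using (by linarith : |euclidLevelSum 1| ≤ C * (2 - 1))
    | succ n ih =>
      have := h (n + 2)
      rw [ellCoeff_add_two] at this
      rw [abs_le] at this ih ⊢
      rw [pow_succ]
      constructor <;> nlinarith
  refine ⟨C, hC, fun n => ?_⟩
  induction n with
  | zero => simp [euclidLevelSum_zero]
  | succ n ih =>
    have := hu n
    have h3 : 0 < C * 3 ^ n ∨ 0 = C * 3 ^ n := (by positivity : 0 ≤ C * 3 ^ n).lt_or_eq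
    rw [abs_le] at this ih ⊢
    push_cast
    rw [pow_succ]
    constructor <;> nlinarith

/-! ### Generating functions -/

theorem summable_ellCoeff {z : ℂ} (hz : ‖z‖ < 1) :
    Summable (fun n : ℕ => (ellCoeff n : ℂ) * z ^ n) := by
  obtain ⟨C, hC, h⟩ := exists_abs_ellCoeff_le
  refine Summable.of_norm_bounded ((summable_geometric_of_lt_one (norm_nonneg z) hz).mul_left C)
    fun n => ?_
  rw [norm_mul, norm_pow, Complex.norm_real, Real.norm_eq_abs]
  gcongr
  exact h n

theorem summable_norm_euclidLevelSum {z : ℂ} (hz : ‖z‖ < 1 / 3) :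
    Summable (fun n : ℕ => ‖(euclidLevelSum n : ℂ) * z ^ n‖) := by
  obtain ⟨C, hC, h⟩ := exists_abs_euclidLevelSum_le
  have hs : Summable (fun n : ℕ => (n : ℝ) * (3 * ‖z‖) ^ n) :=
    (hasSum_coe_mul_geometric_of_norm_lt_one (by
      rw [norm_mul, norm_norm, Real.norm_ofNat]; linarith)).summable
  refine Summable.of_nonneg_of_le (fun _ => norm_nonneg _) (fun n => ?_) (hs.mul_left C)
  rw [norm_mul, norm_pow, Complex.norm_real, Real.norm_eq_abs, mul_pow]
  calc |euclidLevelSum n| * ‖z‖ ^ n ≤ C * (n * 3 ^ n) * ‖z‖ ^ n := by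
        gcongr
        exact h n
    _ = _ := by ring

theorem ellFun_eq {z : ℂ} (hz : ‖z‖ < 1 / 3) :
    ellFun z = (1 - 3 * z) ^ 2 * ∑' n : ℕ, (euclidLevelSum n : ℂ) * z ^ n := by
  have hs := (summable_norm_euclidLevelSum hz).of_norm
  set s : ℕ → ℂ := fun n => (euclidLevelSum n : ℂ) * z ^ n with hsdef
  have h0 : s 0 = 0 := by simp [hsdef, euclidLevelSum_zero]
  have e1 : HasSum (fun n => s (n + 1)) (∑' n, s n) := by
    have := (hasSum_nat_add_iff' (f := s) 1).2 hs.hasSum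
    simpa [h0] using this
  have e2 : HasSum (fun n => s (n + 2)) (∑' n, s n - s 1) := by
    have := (hasSum_nat_add_iff' (f := s) 2).2 hs.hasSum
    simpa [h0, Finset.sum_range_succ] using this
  -- The three-term recurrence for ℓ holds from index 2 on; terms 0 and 1 are restored separately
  -- using s(0) = 0 and ℓ(1) = s(1).
  have e3 : HasSum (fun n => (ellCoeff (n + 2) : ℂ) * z ^ (n + 2))
      ((∑' n, s n - s 1) - 6 * z * ∑' n, s n + 9 * z ^ 2 * ∑' n, s n) := by
    refine HasSum.congr_fun ((e2.sub (e1.mul_left (6 * z))).add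
      (hs.hasSum.mul_left (9 * z ^ 2))) fun n => ?_
    simp only [hsdef, ellCoeff_add_two]
    push_cast
    ring
  have e4 := (summable_ellCoeff (z := z) (by linarith)).hasSum
  have e5 := ((hasSum_nat_add_iff' 2).2 e4).unique e3
  simp only [Finset.sum_range_succ, Finset.range_zero, Finset.sum_empty, ellCoeff_zero,
    ellCoeff_one, euclidLevelSum_zero] at e5
  have h1 : s 1 = (euclidLevelSum 1 : ℂ) * z := by simp [hsdef]
  rw [h1] at e5
  simp only [Complex.ofReal_zero, zero_mul, zero_add, pow_one] at e5
  rw [ellFun]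
  linear_combination e5

theorem differentiableAt_ellFun {z : ℂ} (hz : ‖z‖ < 1) : DifferentiableAt ℂ ellFun z := by
  obtain ⟨C, hC, h⟩ := exists_abs_ellCoeff_le
  obtain ⟨r, hr, hr1⟩ := exists_between hz
  have hr0 : 0 ≤ r := (norm_nonneg z).trans hr.le
  have hd : DifferentiableOn ℂ (fun w => ∑' n : ℕ, (ellCoeff n : ℂ) * w ^ n)
      (Metric.ball 0 r) := by
    refine Complex.differentiableOn_tsum_of_summable_norm
      ((summable_geometric_of_lt_one hr0 hr1).mul_left C) (fun n => by fun_prop)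
      Metric.isOpen_ball fun n w hw => ?_
    rw [norm_mul, norm_pow, Complex.norm_real, Real.norm_eq_abs]
    rw [mem_ball_zero_iff] at hw
    gcongr
    exact h n
  exact hd.differentiableAt (Metric.isOpen_ball.mem_nhds (by simpa using hr))

theorem analyticOnNhd_T32 : AnalyticOnNhd ℂ T32 (Metric.ball (0 : ℂ) 3) := by
  refine DifferentiableOn.analyticOnNhd (fun x hx => ?_) Metric.isOpen_ball
  rw [mem_ball_zero_iff] at hx
  have hx3 : ‖x / 3‖ < 1 := by
    rw [norm_div, Complex.norm_ofNat]; linarith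
  have hne : 1 - x / 3 ≠ 0 := by
    intro h
    rw [← sub_eq_zero.1 h] at hx3
    simp at hx3
  have hL : DifferentiableAt ℂ (fun y : ℂ => ellFun (y / 3)) x :=
    (differentiableAt_ellFun hx3).fun_comp' x (differentiableAt_id.div_const 3)
  refine DifferentiableAt.differentiableWithinAt ?_
  unfold T32
  refine DifferentiableAt.sub (by fun_prop) (DifferentiableAt.mul ?_ hL)
  refine DifferentiableAt.div (by fun_prop) (by fun_prop) ?_
  exact mul_ne_zero (by norm_num) (pow_ne_zero _ hne)

theorem hasSum_sternLogSum {y : ℂ} (hy : ‖y‖ < 1 / 3) :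
    HasSum (fun n : ℕ => (sternLogSum n : ℂ) * y ^ n)
      (2 * (y / (1 - y) ^ 2 * ∑' n : ℕ, (euclidLevelSum n : ℂ) * y ^ n)) := by
  have hy1 : ‖y‖ < 1 := by linarith
  have hs := summable_norm_euclidLevelSum hy
  have hg := hasSum_coe_mul_geometric_of_norm_lt_one hy1
  have hgn : Summable (fun n : ℕ => ‖(n : ℂ) * y ^ n‖) := by
    simpa using summable_norm_pow_mul_geometric_of_norm_lt_one 1 hy1
  -- The sum in `sternLogSum_eq` is a convolution, so the series is twice the Cauchy product of ∑ n
  -- yⁿ and ∑ s(n) yⁿ.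
  have hsum := (summable_norm_sum_mul_antidiagonal_of_summable_norm hgn hs).of_norm
  have htsum := tsum_mul_tsum_eq_tsum_sum_antidiagonal_of_summable_norm hgn hs
  rw [hg.tsum_eq] at htsum
  rw [htsum]
  refine HasSum.congr_fun (hsum.hasSum.mul_left 2) fun n => ?_
  rw [sternLogSum_eq]
  push_cast
  rw [mul_assoc, Finset.sum_mul]
  congr 1
  refine Finset.sum_congr rfl fun p hp => ?_
  rw [← Finset.HasAntidiagonal.mem_antidiagonal.1 hp, pow_add]
  ring

theorem hasSum_uniformEntropy {x : ℂ} (hx : ‖x‖ < 1) :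
    HasSum (fun n : ℕ => (uniformEntropy 3 2 n : ℂ) * x ^ n) (x / (x - 1) ^ 2 * T32 x) := by
  have hy : ‖x / 3‖ < 1 / 3 := by
    rw [norm_div, Complex.norm_ofNat]; linarith
  have h1 := (hasSum_coe_mul_geometric_of_norm_lt_one hx).mul_left (Real.logb 2 3 : ℂ)
  have hval : x / (x - 1) ^ 2 * T32 x = (Real.logb 2 3 : ℂ) * (x / (1 - x) ^ 2) -
      2 * (x / 3 / (1 - x / 3) ^ 2 * ∑' n : ℕ, (euclidLevelSum n : ℂ) * (x / 3) ^ n) := by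
    have hne : x - 1 ≠ 0 := by
      intro h
      rw [sub_eq_zero.1 h] at hx
      simp at hx
    have hne3 : 1 - x / 3 ≠ 0 := by
      intro h
      rw [← sub_eq_zero.1 h] at hy
      norm_num at hy
    rw [T32, ellFun_eq hy]
    rw [show (1 - x) ^ 2 = (x - 1) ^ 2 by ring, show 1 - 3 * (x / 3) = -(x - 1) by ring]
    generalize ∑' n : ℕ, (euclidLevelSum n : ℂ) * (x / 3) ^ n = S
    generalize 1 - x / 3 = t at *
    generalize x - 1 = w at *
    field_simp
  rw [hval]
  refine HasSum.congr_fun (h1.sub (hasSum_sternLogSum hy)) fun n => ?_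
  rw [uniformEntropy_three_two]
  push_cast
  rw [div_pow]
  ring

theorem theorem3p1 :
    -- the power series defining `L` converges on the unit disk
    (∀ z : ℂ, ‖z‖ < 1 → Summable (fun n : ℕ => (ellCoeff n : ℂ) * z ^ n)) ∧
    -- near `0`, `L(z) = (1 - 3z)² ∑_n zⁿ ∑_{e(k,i) = n} k log₂ k`
    (∀ z : ℂ, ‖z‖ < 1 / 3 →
      Summable (fun n : ℕ => (euclidLevelSum n : ℂ) * z ^ n) ∧
      ellFun z = (1 - 3 * z) ^ 2 * ∑' n : ℕ, (euclidLevelSum n : ℂ) * z ^ n) ∧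
    -- `T_{3,2}` is analytic on the disk of radius `3` about `0`
    AnalyticOnNhd ℂ T32 (Metric.ball (0 : ℂ) 3) ∧
    -- the entropy generating function
    (∀ x : ℂ, ‖x‖ < 1 →
      HasSum (fun n : ℕ => (uniformEntropy 3 2 n : ℂ) * x ^ n) (x / (x - 1) ^ 2 * T32 x)) :=
  ⟨fun _ hz => summable_ellCoeff hz,
    fun _ hz => ⟨(summable_norm_euclidLevelSum hz).of_norm, ellFun_eq hz⟩,
    analyticOnNhd_T32, fun _ hx => hasSum_uniformEntropy hx⟩
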